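/- Let $\Sigma$ be a finite nonempty alphabet. A (nondeterministic, transition/state-based) Büchi automaton (BA) over $\Sigma$ is a tuple $\mathcal{A}=(Q,\delta,I,Q_F\cup\delta_F)$ with a finite set $Q$ of states, a transition function $\delta\colon Q\times\Sigma\to 2^Q$, a set $I\subseteq Q$ of initial states, a set $Q_F\subseteq Q$ of accepting states and a set $\delta_F\subseteq\{(p,a,q) : q\in\delta(p,a)\}$ of accepting transitions. A run from $q$ on $\alpha\in\Sigma^\omega$ is a sequence $\rho\colon\omega\to Q$ with $\rho_0=q$ and $\rho_{i+1}\in\delta(\rho_i,\alpha_i)$ for all $i$; it is accepting if some accepting state or some accepting transition occurs in it infinitely often. $\mathcal{L}(\mathcal{A})$ is the set of all $\alpha\in\Sigma^\omega$ on which there is an accepting run from some $q\in I$. Write $\delta(P,a)=\bigcup_{p\in P}\delta(p,a)$ for $P\subseteq Q$. Let $n=|Q|$. A ranking is a function $f\colon Q\to\{0,\dots,2n\}$ that is even on $Q_F$; its rank is $\mathrm{rank}(f)=\max_{q\in Q}f(q)$ (and $0$ if $Q=\emptyset$). For $S\subseteq Q$, $f$ is $S$-tight if $r=\mathrm{rank}(f)$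 is odd, $f(S)\supseteq\{1,3,\dots,r\}$, and $f(q)=0$ for all $q\in Q\setminus S$; let $\mathcal{T}$ be the set of $Q$-tight rankings. Write $f\rightsquigarrow_S^a f'$ if for every $q\in S$ we have $f'(q')\le f(q)$ for all $q'\in\delta(q,a)$, and $f'(q'')\le 2\lfloor f(q)/2\rfloor$ for all $q''$ with $(q,a,q'')\in\delta_F$. The state-based BA $\mathrm{Schewe}(\mathcal{A})=(Q_1\cup Q_2,\delta',\{I\},Q_F'\cup\emptyset)$ is defined as follows. - $Q_1=2^Q$, and $Q_2$ is the set of all $(S,O,f,i)\in 2^Q\times 2^Q\times\mathcal{T}\times\{0,2,\dots,2n-2\}$ such that $f$ is $S$-tight and $O\subseteq S\cap f^{-1}(i)$. - For $S\in Q_1$, $\delta'(S,a)$ consists of $\delta(S,a)\in Q_1$ and of all $(S',\emptyset,f,0)\in Q_2$ with $S'=\delta(S,a)$. - For $(S,O,f,i)\in Q_2$, $\delta'((S,O,f,i),a)$ consists of all $(S',O',f',i')\in Q_2$ such that $S'=\delta(S,a)$, $f\rightsquigarrow_S^a f'$, $\mathrm{rank}(f)=\mathrm{rank}(f')$, and: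 if $O=\emptyset$, then $i'=(i+2)\bmod(\mathrm{rank}(f')+1)$ and $O'=S'\cap f'^{-1}(i')$; if $O\ne\emptyset$, then $i'=i$ and $O'=\delta(O,a)\cap f'^{-1}(i)$. - $Q_F'$ consists of $\emptyset\in Q_1$ and of all $(S,\emptyset,f,i)\in Q_2$. **Theorem.** For every BA $\mathcal{A}$ over $\Sigma$, $\mathcal{L}(\mathrm{Schewe}(\mathcal{A}))=\Sigma^\omega\setminus\mathcal{L}(\mathcal{A})$. -/

import Mathlib

universe u v

/-- A nondeterministic Büchi automaton with states `Q` and alphabet `σ`, with mixed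
state-based (`accStates`) and transition-based (`accTrans`) acceptance. -/
structure BA (Q : Type u) (σ : Type v) where
  finite_states : Finite Q
  step : Q → σ → Set Q
  init : Set Q
  accStates : Set Q
  accTrans : Set (Q × σ × Q)
  accTrans_sub : ∀ p a q, (p, a, q) ∈ accTrans → q ∈ step p a

namespace BA

variable {Q : Type u} {σ : Type v}

/-- The transition function extended to sets of states. -/
def stepSet (A : BA Q σ) (P : Set Q) (a : σ) : Set Q := ⋃ p ∈ P, A.step p a

/-- `ρ` is a run of `A` from `q` on the infinite word `w`. -/
def IsRunFrom (A : BA Q σ) (q : Q) (w : ℕ → σ) (ρ : ℕ → Q) : Prop :=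
  ρ 0 = q ∧ ∀ i, ρ (i + 1) ∈ A.step (ρ i) (w i)

/-- The states that occur infinitely often in `ρ`. -/
def infStates (ρ : ℕ → Q) : Set Q := {q | ∃ᶠ i in Filter.atTop, ρ i = q}

/-- The transitions that occur infinitely often in the run `ρ` on `w`. -/
def infTrans (w : ℕ → σ) (ρ : ℕ → Q) : Set (Q × σ × Q) :=
  {t | ∃ᶠ i in Filter.atTop, (ρ i, w i, ρ (i + 1)) = t}

/-- The run `ρ` on `w` is accepting. -/
def IsAccepting (A : BA Q σ) (w : ℕ → σ) (ρ : ℕ → Q) : Prop :=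
  (infStates ρ ∩ A.accStates).Nonempty ∨ (infTrans w ρ ∩ A.accTrans).Nonempty

/-- The language of the state `q` in `A`. -/
def languageFrom (A : BA Q σ) (q : Q) : Set (ℕ → σ) :=
  {w | ∃ ρ, A.IsRunFrom q w ρ ∧ A.IsAccepting w ρ}

/-- The language of `A`. -/
def language (A : BA Q σ) : Set (ℕ → σ) := ⋃ q ∈ A.init, A.languageFrom q

/-- A level ranking of `A`: a function `Q → {0, …, 2n}`, where `n = |Q|`, that is even on
accepting states. -/
@[ext]
structure Ranking (A : BA Q σ) where
  val : Q → ℕ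
  le_bound : ∀ q, val q ≤ 2 * Nat.card Q
  even_acc : ∀ q ∈ A.accStates, Even (val q)

namespace Ranking

variable {A : BA Q σ}

/-- The rank of a ranking: its largest value (`0` if there are no states). -/
noncomputable def rank (f : Ranking A) : ℕ := ⨆ q, f.val q

/-- `f` is `S`-tight: its rank `r` is odd, `f(S) ⊇ {1, 3, …, r}`, and `f` is zero
outside `S`. -/
def IsTight (f : Ranking A) (S : Set Q) : Prop :=
  Odd f.rank ∧ {j | Odd j ∧ j ≤ f.rank} ⊆ f.val '' S ∧ ∀ q, q ∉ S → f.val q = 0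

/-- The largest even number that is at most `k`. -/
def evenFloor (k : ℕ) : ℕ := 2 * (k / 2)

/-- The consistency relation between rankings of consecutive levels, for the set `S` of
states and the letter `a`. -/
def Consistent (S : Set Q) (a : σ) (f f' : Ranking A) : Prop :=
  ∀ q ∈ S,
    (∀ q' ∈ A.step q a, f'.val q' ≤ f.val q) ∧
    (∀ q', (q, a, q') ∈ A.accTrans → f'.val q' ≤ evenFloor (f.val q))

theorem finite (A : BA Q σ) : Finite (Ranking A) := by
  have := A.finite_states
  refine Finite.of_injective
    (fun (f : Ranking A) (q : Q) =>
      (⟨f.val q, Nat.lt_succ_of_le (f.le_bound q)⟩ : Fin (2 * Nat.card Q + 1))) ?_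
  intro f g h
  ext q
  have := congrFun h q
  simpa using this

end Ranking

/-- The macrostates `(S, O, f, i)` of the tight part. The index `i` ranges over
`{0, 2, …, 2n - 2}`, where `n = |Q|`. -/
@[ext]
structure TightState (A : BA Q σ) where
  S : Set Q
  O : Set Q
  f : Ranking A
  i : ℕ
  f_tight : f.IsTight Set.univ
  f_tightOn : f.IsTight S
  i_even : Even i
  i_le : i + 2 ≤ 2 * Nat.card Q
  O_sub : O ⊆ S ∩ f.val ⁻¹' {i}

theorem TightState.finite (A : BA Q σ) : Finite (TightState A) := by
  have := A.finite_states
  have := Ranking.finite A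
  refine Finite.of_injective
    (fun (m : TightState A) =>
      (m.S, m.O, m.f, (⟨m.i, by have := m.i_le; omega⟩ : Fin (2 * Nat.card Q)))) ?_
  intro m m' h
  simp only [Prod.mk.injEq, Fin.mk.injEq] at h
  exact TightState.ext h.1 h.2.1 h.2.2.1 h.2.2.2

/-- The states of the complement automaton: the waiting part `2^Q` and the tight part. -/
abbrev ScheweState (A : BA Q σ) : Type u := Set Q ⊕ TightState A

/-- The transitions inside the waiting part. -/
def scheweStep₁ (A : BA Q σ) (S : Set Q) (a : σ) : Set (Set Q) := {A.stepSet S a}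

/-- The transitions from the waiting part to the tight part. (That `m.f` is `m.S`-tight
is part of `TightState`.) -/
def scheweStep₂ (A : BA Q σ) (S : Set Q) (a : σ) : Set (TightState A) :=
  {m | m.S = A.stepSet S a ∧ m.O = ∅ ∧ m.i = 0}

/-- The transitions inside the tight part. -/
def scheweStep₃ (A : BA Q σ) (m : TightState A) (a : σ) : Set (TightState A) :=
  {m' | m'.S = A.stepSet m.S a ∧
        Ranking.Consistent m.S a m.f m'.f ∧
        m.f.rank = m'.f.rank ∧
        (m.O = ∅ → m'.i = (m.i + 2) % (m'.f.rank + 1) ∧ m'.O = m'.S ∩ m'.f.val ⁻¹' {m'.i}) ∧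
        (m.O ≠ ∅ → m'.i = m.i ∧ m'.O = A.stepSet m.O a ∩ m'.f.val ⁻¹' {m.i})}

/-- Schewe's rank-based complement of `A`, a state-based Büchi automaton. -/
def schewe (A : BA Q σ) : BA (ScheweState A) σ where
  finite_states := by
    have := A.finite_states
    have := TightState.finite A
    infer_instance
  step
    | Sum.inl S, a => Sum.inl '' A.scheweStep₁ S a ∪ Sum.inr '' A.scheweStep₂ S a
    | Sum.inr m, a => Sum.inr '' A.scheweStep₃ m a
  init := {Sum.inl A.init}
  accStates := {Sum.inl ∅} ∪ Sum.inr '' {m | m.O = ∅}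
  accTrans := ∅
  accTrans_sub := fun _ _ _ h => h.elim

end BA

/-!
Both inclusions rest on ranks of vertices in the run graph of `A` on `w`, whose level `k` consists
of the states reachable by the first `k` letters.

If the complement automaton accepts `w`, a run of `A` on `w` keeps every level nonempty, so the
accepting run of the complement enters its tight part. There the ranks along the run of `A` do not
increase, hence become constant. If the run of `A` were accepting, this constant `c` would be even,
as an accepting state has an even rank and an accepting transition leads to at most an even rank.
The breakpoint set is empty infinitely often, so the index `i` runs through all even numbers below
the rank. When it reaches `c`, the breakpoint set catches the run of `A` and is never empty again
(`not_even_of_tight_run`).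

If `A` rejects `w`, the ranks come from peeling the run graph: remove alternately the vertices
of finite height and the vertices from which no accepting edge can be reached (`peel`). The rank of
a vertex is the index of the stage after which it is removed. As long as a stage of even index
`2 * i` is nonempty on infinitely many levels, the next stage is nonempty, each of its vertices has
a successor in it, and some vertex reaches no accepting edge, since otherwise there would be an
accepting run; so rank `2 * i + 1` occurs on all late levels (`eventually_exists_odd_rank`). As
different ranks belong to different states, this happens for at most `|Q|` values of `i`, and
the ranks on late levels form tight rankings (`eventually_tight`). Vertices of even rank have
finite height in their stage, which empties the breakpoint sets (`exists_empty_of_even_rank`).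
If some level of the run graph is empty, the waiting part alone provides an accepting run.
-/

namespace BA

variable {Q : Type u} {σ : Type v}

theorem mem_stepSet {A : BA Q σ} {P : Set Q} {a : σ} {q : Q} :
    q ∈ A.stepSet P a ↔ ∃ p ∈ P, q ∈ A.step p a := by
  simp [stepSet]

theorem frequently_exists_of_finite {ι : Type*} [Finite ι] {P : ι → ℕ → Prop}
    (h : ∃ᶠ k in Filter.atTop, ∃ x, P x k) : ∃ x, ∃ᶠ k in Filter.atTop, P x k := by
  by_contra hc
  simp only [not_exists, Filter.not_frequently] at hc
  refine h ?_
  filter_upwards [Filter.eventually_all.2 hc] with k hk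
  simpa using hk

/-- The states of `A` that are reachable from an initial state by the first `k` letters. -/
def level (A : BA Q σ) (w : ℕ → σ) : ℕ → Set Q
  | 0 => A.init
  | k + 1 => A.stepSet (level A w k) (w k)

theorem IsRunFrom.mem_level {A : BA Q σ} {w : ℕ → σ} {q : Q} {ρ : ℕ → Q}
    (h : A.IsRunFrom q w ρ) (hq : q ∈ A.init) (k : ℕ) : ρ k ∈ A.level w k := by
  induction k with
  | zero => rw [h.1]; exact hq
  | succ k ih => exact mem_stepSet.2 ⟨_, ih, h.2 k⟩

/-- A transition that is accepting itself or leaves an accepting state. -/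
def IsAccEdge (A : BA Q σ) (a : σ) (p q : Q) : Prop :=
  q ∈ A.step p a ∧ (p ∈ A.accStates ∨ (p, a, q) ∈ A.accTrans)

/-- Both finiteness assumptions matter here: infinitely many accepting edges only yield a single
recurring state or transition by the pigeonhole principle. -/
theorem IsRunFrom.isAccepting_iff [Finite σ] {A : BA Q σ} {w : ℕ → σ} {q : Q} {ρ : ℕ → Q}
    (h : A.IsRunFrom q w ρ) :
    A.IsAccepting w ρ ↔ ∃ᶠ k in Filter.atTop, A.IsAccEdge (w k) (ρ k) (ρ (k + 1)) := by
  have := A.finite_states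
  constructor
  · rintro (⟨p, hp, hF⟩ | ⟨t, ht, hF⟩)
    · exact hp.mono fun k hk => ⟨h.2 k, Or.inl (hk ▸ hF)⟩
    · exact ht.mono fun k hk => ⟨h.2 k, Or.inr (hk ▸ hF)⟩
  · intro hf
    have hf' : (∃ᶠ k in Filter.atTop, ρ k ∈ A.accStates) ∨
        ∃ᶠ k in Filter.atTop, (ρ k, w k, ρ (k + 1)) ∈ A.accTrans :=
      Filter.frequently_or_distrib.1 (hf.mono fun k hk => hk.2)
    refine hf'.imp (fun h1 => ?_) (fun h1 => ?_)
    · obtain ⟨p, hp⟩ := frequently_exists_of_finite (P := fun p k => ρ k = p ∧ p ∈ A.accStates)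
        (h1.mono fun k hk => ⟨_, rfl, hk⟩)
      exact ⟨p, hp.mono fun k hk => hk.1, hp.exists.choose_spec.2⟩
    · obtain ⟨t, ht⟩ := frequently_exists_of_finite
        (P := fun t k => (ρ k, w k, ρ (k + 1)) = t ∧ t ∈ A.accTrans)
        (h1.mono fun k hk => ⟨_, rfl, hk⟩)
      exact ⟨t, ht.mono fun k hk => hk.1, ht.exists.choose_spec.2⟩

/-! ### Soundness -/

/-- Breakpoint argument: in an infinite sequence of tight states whose breakpoint sets are empty
infinitely often, the index `i` runs through all even numbers below the rank, hence a path whose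
rank stays at one even number `c` would eventually be caught in the breakpoint set with
index `c`. -/
theorem not_even_of_tight_run {A : BA Q σ} {w : ℕ → σ} {T : ℕ → TightState A} {q : ℕ → Q} {c : ℕ}
    (hT : ∀ j, T (j + 1) ∈ A.scheweStep₃ (T j) (w j))
    (hO : ∃ᶠ j in Filter.atTop, (T j).O = ∅)
    (hq : ∀ j, q (j + 1) ∈ A.step (q j) (w j))
    (hS : ∀ j, q j ∈ (T j).S) (hc : ∀ j, (T j).f.val (q j) = c) : ¬ Even c := by
  intro hce
  have := A.finite_states
  set r := (T 0).f.rank with hr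
  have hrank : ∀ j, (T j).f.rank = r := by
    intro j
    induction j with
    | zero => rfl
    | succ j ih => rw [← (hT j).2.2.1, ih]
  have hodd : Odd r := (T 0).f_tight.1
  have hcr : c ≤ r := by
    rw [← hc 0, hr]
    exact le_ciSup (f := (T 0).f.val) (Set.finite_range _).bddAbove (q 0)
  have hwait : ∀ j, ∃ j' ≥ j, (T j').O = ∅ ∧ (T j').i = (T j).i := by
    intro j
    obtain ⟨l, hl⟩ := Filter.frequently_atTop.1 hO j
    obtain ⟨d, rfl⟩ := Nat.exists_eq_add_of_le hl.1
    replace hl := hl.2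
    induction d generalizing j with
    | zero => exact ⟨j, le_rfl, hl, rfl⟩
    | succ d ih =>
      by_cases he : (T j).O = ∅
      · exact ⟨j, le_rfl, he, rfl⟩
      · obtain ⟨j', h1, h2, h3⟩ := ih (j + 1) (by rwa [Nat.add_right_comm, Nat.add_assoc])
        exact ⟨j', by omega, h2, by rw [h3, ((hT j).2.2.2.2 he).1]⟩
  have hcycle : ∀ t, ∃ j, (T j).O = ∅ ∧ (T j).i % (r + 1) = ((T 0).i + 2 * t) % (r + 1) := by
    intro t
    induction t with
    | zero =>
      obtain ⟨j, -, h1, h2⟩ := hwait 0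
      exact ⟨j, h1, by rw [h2]; rfl⟩
    | succ t ih =>
      obtain ⟨j, h1, h2⟩ := ih
      obtain ⟨j', -, h3, h4⟩ := hwait (j + 1)
      refine ⟨j', h3, ?_⟩
      rw [h4, ((hT j).2.2.2.1 h1).1, hrank, Nat.mod_mod, Nat.add_mod, h2, ← Nat.add_mod]
      ring_nf
  obtain ⟨M, hM⟩ := hodd
  obtain ⟨a, ha⟩ := (T 0).i_even
  obtain ⟨b, hb⟩ := hce
  -- `2 * (a + 1 + t) = c + (r + 1) * (a + 1)`, so the next index after this breakpoint is `c`
  obtain ⟨j, hj, hji⟩ := hcycle (b + M * (a + 1))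
  have hi : (T (j + 1)).i = c := by
    rw [((hT j).2.2.2.1 hj).1, hrank, Nat.add_mod, hji, ← Nat.add_mod]
    have : (T 0).i + 2 * (b + M * (a + 1)) + 2 = c + (r + 1) * (a + 1) := by
      rw [ha, hb, hM]; ring
    rw [this, Nat.add_mul_mod_self_left, Nat.mod_eq_of_lt (by omega)]
  have hcaught : ∀ d, (T (j + 1 + d)).i = c ∧ q (j + 1 + d) ∈ (T (j + 1 + d)).O := by
    intro d
    induction d with
    | zero =>
      refine ⟨hi, ?_⟩
      rw [Nat.add_zero, ((hT j).2.2.2.1 hj).2]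
      exact ⟨hS _, by simp [hc, hi]⟩
    | succ d ih =>
      have h1 := (hT (j + 1 + d)).2.2.2.2 (Set.nonempty_iff_ne_empty.1 ⟨_, ih.2⟩)
      rw [← Nat.add_assoc]
      refine ⟨h1.1.trans ih.1, ?_⟩
      rw [h1.2]
      exact ⟨mem_stepSet.2 ⟨_, ih.2, hq _⟩, by simp [hc, ih.1]⟩
  obtain ⟨l, hl, hlO⟩ := Filter.frequently_atTop.1 hO (j + 1)
  obtain ⟨d, rfl⟩ := Nat.exists_eq_add_of_le hl
  have := (hcaught d).2
  rw [hlO] at this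
  exact this

/-- The set of states of `A` that a state of the complement automaton tracks. -/
def ScheweState.support {A : BA Q σ} : ScheweState A → Set Q := Sum.elim id TightState.S

theorem support_eq_level {A : BA Q σ} {w : ℕ → σ} {R : ℕ → ScheweState A}
    (hR : A.schewe.IsRunFrom (Sum.inl A.init) w R) (k : ℕ) :
    ScheweState.support (R k) = A.level w k := by
  induction k with
  | zero => rw [hR.1]; rfl
  | succ k ih =>
    have h := hR.2 k
    rw [level, ← ih]
    rcases hk : R k with S | m
    · rw [hk] at h
      rcases h with ⟨S', h1, h2⟩ | ⟨m, h1, h2⟩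
      · rw [← h2]; exact h1
      · rw [← h2]; exact h1.1
    · rw [hk] at h
      obtain ⟨m', h1, h2⟩ := h
      rw [← h2]; exact h1.1

theorem exists_tight_tail {A : BA Q σ} {w : ℕ → σ} {R : ℕ → ScheweState A} {s : ScheweState A}
    (hR : A.schewe.IsRunFrom s w R) {K : ℕ} {m : TightState A} (hK : R K = Sum.inr m) :
    ∃ T : ℕ → TightState A, (∀ j, R (K + j) = Sum.inr (T j)) ∧
      ∀ j, T (j + 1) ∈ A.scheweStep₃ (T j) (w (K + j)) := by
  have h : ∀ j, ∃ t, R (K + j) = Sum.inr t := by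
    intro j
    induction j with
    | zero => exact ⟨m, hK⟩
    | succ j ih =>
      obtain ⟨t, ht⟩ := ih
      have h := hR.2 (K + j)
      rw [ht] at h
      obtain ⟨m', -, h2⟩ := h
      exact ⟨m', h2.symm⟩
  choose T hT using h
  refine ⟨T, hT, fun j => ?_⟩
  have h := hR.2 (K + j)
  rw [hT j] at h
  obtain ⟨m', h1, h2⟩ := h
  have := (hT (j + 1)).symm.trans h2.symm
  rw [Sum.inr.inj this]
  exact h1

theorem disjoint_language_schewe [Finite σ] (A : BA Q σ) {w : ℕ → σ}
    (hw : w ∈ A.schewe.language) : w ∉ A.language := by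
  intro hA
  simp only [language, Set.mem_iUnion] at hA hw
  obtain ⟨q₀, hq₀, ρ, hρ, hacc⟩ := hA
  obtain ⟨s, hs, R, hR, hRacc⟩ := hw
  obtain rfl : s = Sum.inl A.init := hs
  have hlev := hρ.mem_level hq₀
  have hsupp := support_eq_level hR
  rw [hρ.isAccepting_iff] at hacc
  have hO : ∃ᶠ k in Filter.atTop, ∃ m : TightState A, R k = Sum.inr m ∧ m.O = ∅ := by
    refine ((hR.isAccepting_iff).1 hRacc).mono fun k hk => ?_
    rcases hk.2 with (h | ⟨m, h1, h2⟩) | h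
    · have := hlev k
      rw [← hsupp k, h] at this
      exact this.elim
    · exact ⟨m, h2.symm, h1⟩
    · exact h.elim
  obtain ⟨K, m, hK, -⟩ := hO.exists
  obtain ⟨T, hT, hstep⟩ := exists_tight_tail hR hK
  have hS : ∀ j, ρ (K + j) ∈ (T j).S := by
    intro j
    have h1 := hsupp (K + j)
    rw [hT j] at h1
    have h2 := hlev (K + j)
    rw [← h1] at h2
    exact h2
  let v : ℕ → ℕ := fun j => (T j).f.val (ρ (K + j))
  have hv : Antitone v := antitone_nat_of_succ_le fun j =>
    ((hstep j).2.1 _ (hS j)).1 _ (hρ.2 (K + j))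
  obtain ⟨N, hN⟩ : ∃ N, ∀ j, v (N + j) = v N := by
    obtain ⟨N, hN⟩ := WellFounded.has_min (wellFounded_lt (α := ℕ)) (Set.range v) ⟨_, 0, rfl⟩
    obtain ⟨⟨N, rfl⟩, h⟩ := hN
    exact ⟨N, fun j => le_antisymm (hv (Nat.le_add_right _ _)) (not_lt.1 (h _ ⟨_, rfl⟩))⟩
  have hev : Even (v N) := by
    obtain ⟨k, hk, -, hF⟩ := Filter.frequently_atTop.1 hacc (K + N)
    obtain ⟨d, rfl⟩ := Nat.exists_eq_add_of_le hk
    rw [Nat.add_assoc] at hF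
    rcases hF with hF | hF
    · rw [← hN d]
      exact (T (N + d)).f.even_acc _ hF
    · have h1 : v (N + d + 1) ≤ Ranking.evenFloor (v (N + d)) :=
        ((hstep (N + d)).2.1 _ (hS _)).2 _ hF
      rw [Nat.add_assoc, hN, hN, Ranking.evenFloor] at h1
      exact ⟨v N / 2, by omega⟩
  refine not_even_of_tight_run (w := fun j => w (K + (N + j))) (T := fun j => T (N + j))
    (q := fun j => ρ (K + (N + j))) (fun j => hstep (N + j)) ?_ (fun j => hρ.2 (K + (N + j)))
    (fun j => hS (N + j)) hN hev
  rw [Filter.frequently_atTop] at hO ⊢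
  intro a
  obtain ⟨b, hb, m, h1, h2⟩ := hO (K + (N + a))
  obtain ⟨d, rfl⟩ := Nat.exists_eq_add_of_le hb
  refine ⟨a + d, Nat.le_add_right _ _, ?_⟩
  have : R (K + (N + (a + d))) = Sum.inr m := by rw [← h1]; congr 1; omega
  rw [Sum.inr.inj ((hT _).symm.trans this)]
  exact h2

/-! ### Peeling the run graph -/

/-- In the part `X` of the run graph, a path of length `n` starts at the vertex `q` of level `k`. -/
def HasPath (A : BA Q σ) (w : ℕ → σ) (X : ℕ → Set Q) : ℕ → ℕ → Q → Prop
  | 0, k, q => q ∈ X k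
  | n + 1, k, q => q ∈ X k ∧ ∃ q' ∈ A.step q (w k), HasPath A w X n (k + 1) q'

/-- In the part `X` of the run graph, a path of length `n` leads from the vertex `q` of level `k`
to an accepting edge. -/
def ReachesAcc (A : BA Q σ) (w : ℕ → σ) (X : ℕ → Set Q) : ℕ → ℕ → Q → Prop
  | 0, k, q => q ∈ X k ∧ ∃ q' ∈ X (k + 1), A.IsAccEdge (w k) q q'
  | n + 1, k, q => q ∈ X k ∧ ∃ q' ∈ A.step q (w k), ReachesAcc A w X n (k + 1) q'

open Classical in
/-- The decreasing sequence of subgraphs of the run graph of `A` on `w`, given level by level: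
at even indices the vertices of finite height are removed next, at odd indices those from which no
accepting edge can be reached. -/
def peel (A : BA Q σ) (w : ℕ → σ) : ℕ → ℕ → Set Q
  | 0 => A.level w
  | j + 1 => if Even j then fun k => {q | ∀ n, A.HasPath w (peel A w j) n k q}
      else fun k => {q | ∃ n, A.ReachesAcc w (peel A w j) n k q}

section Peel

variable {A : BA Q σ} {w : ℕ → σ}

theorem HasPath.mem {X : ℕ → Set Q} {n k : ℕ} {q : Q} (h : A.HasPath w X n k q) : q ∈ X k := by
  cases n with
  | zero => exact h
  | succ n => exact h.1

theorem ReachesAcc.mem {X : ℕ → Set Q} {n k : ℕ} {q : Q} (h : A.ReachesAcc w X n k q) :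
    q ∈ X k := by
  cases n <;> exact h.1

theorem HasPath.of_le {X : ℕ → Set Q} {m n k : ℕ} {q : Q} (h : A.HasPath w X n k q)
    (hmn : m ≤ n) : A.HasPath w X m k q := by
  induction m generalizing n k q with
  | zero => exact h.mem
  | succ m ih =>
    obtain ⟨n, rfl⟩ := Nat.exists_eq_add_of_le' (show 1 ≤ n by omega)
    obtain ⟨h1, q', h2, h3⟩ := h
    exact ⟨h1, q', h2, ih h3 (by omega)⟩

theorem mem_peel_odd {i k : ℕ} {q : Q} :
    q ∈ A.peel w (2 * i + 1) k ↔ ∀ n, A.HasPath w (A.peel w (2 * i)) n k q := by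
  simp [peel]

theorem mem_peel_even {i k : ℕ} {q : Q} :
    q ∈ A.peel w (2 * i + 2) k ↔ ∃ n, A.ReachesAcc w (A.peel w (2 * i + 1)) n k q := by
  rw [peel, if_neg (by simp)]; rfl

theorem peel_succ_subset (j k : ℕ) : A.peel w (j + 1) k ⊆ A.peel w j k := by
  intro q hq
  obtain ⟨i, rfl | rfl⟩ := Nat.even_or_odd' j
  · exact (mem_peel_odd.1 hq 0).mem
  · exact (mem_peel_even.1 hq).choose_spec.mem

theorem peel_antitone (k : ℕ) : Antitone fun j => A.peel w j k :=
  antitone_nat_of_succ_le fun j => peel_succ_subset j k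

theorem peel_subset_level (j k : ℕ) : A.peel w j k ⊆ A.level w k := peel_antitone k (Nat.zero_le j)

/-- The subgraphs are closed under predecessors; so ranks do not increase along edges. -/
theorem mem_peel_of_step {j k : ℕ} {p q : Q} (hp : p ∈ A.level w k) (hpq : q ∈ A.step p (w k))
    (hq : q ∈ A.peel w j (k + 1)) : p ∈ A.peel w j k := by
  induction j with
  | zero => exact hp
  | succ j ih =>
    have hpj := ih (peel_succ_subset _ _ hq)
    obtain ⟨i, rfl | rfl⟩ := Nat.even_or_odd' j
    · rw [mem_peel_odd] at hq ⊢
      intro n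
      exact HasPath.of_le (n := n + 1) ⟨hpj, q, hpq, hq n⟩ (Nat.le_succ n)
    · obtain ⟨n, hn⟩ := mem_peel_even.1 hq
      exact mem_peel_even.2 ⟨n + 1, hpj, q, hpq, hn⟩

/-- As the run graph is finitely branching, a vertex of infinite height has a successor of infinite
height. -/
theorem exists_succ_mem_peel_odd {i k : ℕ} {q : Q} (hq : q ∈ A.peel w (2 * i + 1) k) :
    ∃ q' ∈ A.step q (w k), q' ∈ A.peel w (2 * i + 1) (k + 1) := by
  have := A.finite_states
  obtain ⟨q', hq'⟩ := frequently_exists_of_finite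
    (P := fun q' n => q' ∈ A.step q (w k) ∧ A.HasPath w (A.peel w (2 * i)) n (k + 1) q')
    (Filter.Frequently.of_forall fun n => (mem_peel_odd.1 hq (n + 1)).2)
  refine ⟨q', hq'.exists.choose_spec.1, mem_peel_odd.2 fun n => ?_⟩
  obtain ⟨m, hm, h⟩ := Filter.frequently_atTop.1 hq' n
  exact h.2.of_le hm

/-- Going back to level `0` along predecessors yields a long path from there. -/
theorem exists_hasPath_of_mem_peel {j k n : ℕ} {q : Q} (hq : A.HasPath w (A.peel w j) n k q) :
    ∃ q₀, A.HasPath w (A.peel w j) (n + k) 0 q₀ := by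
  induction k generalizing n q with
  | zero => exact ⟨q, hq⟩
  | succ k ih =>
    obtain ⟨p, hp, hpq⟩ := mem_stepSet.1 (peel_subset_level _ _ hq.mem)
    have := ih (n := n + 1) (q := p) ⟨mem_peel_of_step hp hpq hq.mem, q, hpq, hq⟩
    rwa [Nat.add_right_comm, Nat.add_assoc] at this

theorem peel_odd_nonempty {i : ℕ}
    (h : ∃ᶠ k in Filter.atTop, (A.peel w (2 * i) k).Nonempty) :
    (A.peel w (2 * i + 1) 0).Nonempty := by
  have := A.finite_states
  obtain ⟨q, hq⟩ := frequently_exists_of_finite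
    (P := fun q n => A.HasPath w (A.peel w (2 * i)) n 0 q)
    (h.mono fun k ⟨q, hq⟩ => by
      simpa using exists_hasPath_of_mem_peel (n := 0) (k := k) (q := q) hq)
  refine ⟨q, mem_peel_odd.2 fun n => ?_⟩
  obtain ⟨m, hm, h⟩ := Filter.frequently_atTop.1 hq n
  exact h.of_le hm

theorem exists_run_of_reachesAcc {X : ℕ → Set Q} {q : Q} (hq : q ∈ X 0)
    (hX : ∀ k, ∀ p ∈ X k, ∃ n, A.ReachesAcc w X n k p) :
    ∃ ρ, A.IsRunFrom q w ρ ∧ ∃ᶠ k in Filter.atTop, A.IsAccEdge (w k) (ρ k) (ρ (k + 1)) := by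
  -- following shortest paths, the distance `d` to an accepting edge drops until one is taken
  let d : ℕ → Q → ℕ := fun k p => sInf {n | A.ReachesAcc w X n k p}
  have hnext : ∀ k p, p ∈ X k → ∃ p' ∈ X (k + 1), p' ∈ A.step p (w k) ∧
      (A.IsAccEdge (w k) p p' ∨ d (k + 1) p' < d k p) := by
    intro k p hp
    have hd : A.ReachesAcc w X (d k p) k p := Nat.sInf_mem (hX k p hp)
    rcases hdn : d k p with _ | n
    · rw [hdn] at hd
      obtain ⟨-, p', h1, h2⟩ := hd
      exact ⟨p', h1, h2.1, Or.inl h2⟩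
    · rw [hdn] at hd
      obtain ⟨-, p', h1, h2⟩ := hd
      exact ⟨p', h2.mem, h1, Or.inr (Nat.lt_succ_of_le (Nat.sInf_le h2))⟩
  have : Nonempty Q := ⟨q⟩
  choose! next hmem hstep hdec using hnext
  let ρ : ℕ → Q := fun k => Nat.rec q (fun k p => next k p) k
  have hρ : ∀ k, ρ k ∈ X k := by
    intro k
    induction k with
    | zero => exact hq
    | succ k ih => exact hmem k _ ih
  refine ⟨ρ, ⟨rfl, fun k => hstep k _ (hρ k)⟩, fun hev => ?_⟩
  obtain ⟨N, hN⟩ := Filter.eventually_atTop.1 hev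
  have hlt : ∀ j, d (N + j) (ρ (N + j)) + j ≤ d N (ρ N) := by
    intro j
    induction j with
    | zero => exact le_rfl
    | succ j ih =>
      have : d (N + j + 1) (ρ (N + j + 1)) < d (N + j) (ρ (N + j)) :=
        (hdec _ _ (hρ (N + j))).resolve_left (hN _ (Nat.le_add_right _ _))
      rw [← Nat.add_assoc N j 1]
      omega
  have := hlt (d N (ρ N) + 1)
  omega

/-- If a word is rejected and an even stage is infinite, the following odd stage contains a vertex
reaching no accepting edge, and together with it a whole infinite path of such vertices. -/
theorem eventually_exists_odd_rank [Finite σ] (hw : w ∉ A.language) {i : ℕ}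
    (h : ∃ᶠ k in Filter.atTop, (A.peel w (2 * i) k).Nonempty) :
    ∀ᶠ k in Filter.atTop, (A.peel w (2 * i + 1) k \ A.peel w (2 * i + 2) k).Nonempty := by
  obtain ⟨q₀, hq₀⟩ := peel_odd_nonempty h
  obtain ⟨k₀, p, hp, hp'⟩ : ∃ k, ∃ p ∈ A.peel w (2 * i + 1) k, p ∉ A.peel w (2 * i + 2) k := by
    by_contra! hc
    obtain ⟨ρ, hρ, hacc⟩ := exists_run_of_reachesAcc hq₀ fun k p hp => mem_peel_even.1 (hc k p hp)
    refine hw (Set.mem_biUnion (x := q₀) (peel_subset_level _ _ hq₀) ⟨ρ, hρ, ?_⟩)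
    exact hρ.isAccepting_iff.2 hacc
  filter_upwards [Filter.eventually_ge_atTop k₀] with k hk
  induction k, hk using Nat.le_induction with
  | base => exact ⟨p, hp, hp'⟩
  | succ k _ ih =>
    obtain ⟨q, hq, hq'⟩ := ih
    obtain ⟨q', h1, h2⟩ := exists_succ_mem_peel_odd hq
    exact ⟨q', h2, fun h3 => hq' (mem_peel_of_step (peel_subset_level _ _ hq) h1 h3)⟩

end Peel

/-! ### Ranks of vertices -/

/-- The rank of the vertex `q` of level `k`: the index of the stage after which it is removed.
It is `0` for states outside the level; it is meaningless for vertices that are never removed. -/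
noncomputable def vertexRank (A : BA Q σ) (w : ℕ → σ) (k : ℕ) (q : Q) : ℕ :=
  sInf {j | q ∉ A.peel w (j + 1) k}

section VertexRank

variable {A : BA Q σ} {w : ℕ → σ} {k : ℕ} {q : Q}

theorem vertexRank_eq {j : ℕ} (h1 : q ∈ A.peel w j k) (h2 : q ∉ A.peel w (j + 1) k) :
    A.vertexRank w k q = j := by
  refine le_antisymm (Nat.sInf_le h2) (le_csInf ⟨j, h2⟩ fun l hl => ?_)
  by_contra! hlt
  exact hl (peel_antitone k hlt h1)

theorem vertexRank_le {j : ℕ} (h : q ∉ A.peel w (j + 1) k) : A.vertexRank w k q ≤ j :=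
  Nat.sInf_le h

theorem vertexRank_eq_zero (h : q ∉ A.level w k) : A.vertexRank w k q = 0 :=
  Nat.le_zero.1 (vertexRank_le fun h' => h (peel_subset_level _ _ h'))

theorem notMem_peel_vertexRank {j : ℕ} (h : A.peel w j k = ∅) :
    q ∉ A.peel w (A.vertexRank w k q + 1) k :=
  Nat.sInf_mem (s := {j | q ∉ A.peel w (j + 1) k})
    ⟨j, fun h' => by simpa [h] using peel_succ_subset _ _ h'⟩

theorem mem_peel_vertexRank (hq : q ∈ A.level w k) : q ∈ A.peel w (A.vertexRank w k q) k := by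
  rcases h : A.vertexRank w k q with _ | j
  · exact hq
  · by_contra hc
    have := vertexRank_le hc
    omega

theorem even_vertexRank_of_mem_accStates {m : ℕ} (hm : A.peel w m k = ∅)
    (hq : q ∈ A.accStates) : Even (A.vertexRank w k q) := by
  by_cases hl : q ∈ A.level w k
  · by_contra hodd
    obtain ⟨i, hi⟩ := Nat.not_even_iff_odd.1 hodd
    have h1 := mem_peel_vertexRank hl
    have h2 := notMem_peel_vertexRank (q := q) hm
    rw [hi] at h1 h2
    -- a vertex of odd rank has a successor in its stage, so an accepting state has an accepting edge
    obtain ⟨q', h3, h4⟩ := exists_succ_mem_peel_odd h1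
    exact h2 (mem_peel_even.2 ⟨0, h1, q', h4, h3, Or.inl hq⟩)
  · rw [vertexRank_eq_zero hl]
    exact Even.zero

theorem vertexRank_le_of_step {m : ℕ} (hm : A.peel w m k = ∅) (hq : q ∈ A.level w k) {q' : Q}
    (hqq : q' ∈ A.step q (w k)) : A.vertexRank w (k + 1) q' ≤ A.vertexRank w k q :=
  vertexRank_le fun h => notMem_peel_vertexRank hm (mem_peel_of_step hq hqq h)

theorem vertexRank_le_of_accTrans {m : ℕ} (hm : A.peel w m k = ∅) (hq : q ∈ A.level w k) {q' : Q}
    (hqq : (q, w k, q') ∈ A.accTrans) :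
    A.vertexRank w (k + 1) q' ≤ Ranking.evenFloor (A.vertexRank w k q) := by
  have hs := A.accTrans_sub _ _ _ hqq
  obtain ⟨i, hi | hi⟩ := Nat.even_or_odd' (A.vertexRank w k q)
  · have := vertexRank_le_of_step hm hq hs
    rw [Ranking.evenFloor]
    omega
  · have h1 := mem_peel_vertexRank hq
    have h2 := notMem_peel_vertexRank (q := q) hm
    rw [hi] at h1 h2
    have h3 : A.vertexRank w (k + 1) q' ≤ 2 * i := vertexRank_le fun h =>
      h2 (mem_peel_even.2 ⟨0, h1, q', h, hs, Or.inr hqq⟩)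
    rw [Ranking.evenFloor]
    omega

/-- A sequence of breakpoint sets with constant even index follows vertices of finite height and
therefore dies out. -/
theorem exists_empty_of_even_rank {m i : ℕ} {O : ℕ → Set Q} (hm : ∀ j, A.peel w m (k + j) = ∅)
    (hO : ∀ j, O j ⊆ A.level w (k + j) ∩ A.vertexRank w (k + j) ⁻¹' {2 * i})
    (hstep : ∀ j, O (j + 1) ⊆ A.stepSet (O j) (w (k + j))) : ∃ j, O j = ∅ := by
  have := A.finite_states
  by_contra! hne
  have hmem : ∀ j, O j ⊆ A.peel w (2 * i) (k + j) := fun j q hq => by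
    have := mem_peel_vertexRank (hO j hq).1
    rwa [(hO j hq).2] at this
  have hpath : ∀ j n, ∀ q ∈ O j, A.HasPath w (A.peel w (2 * i)) n (k + j) q →
      ∃ p ∈ O 0, A.HasPath w (A.peel w (2 * i)) (n + j) k p := by
    intro j
    induction j with
    | zero => exact fun n q hq h => ⟨q, hq, h⟩
    | succ j ih =>
      intro n q hq h
      obtain ⟨p, hp, hpq⟩ := mem_stepSet.1 (hstep j hq)
      have := ih (n + 1) p hp ⟨hmem j hp, q, hpq, h⟩
      rwa [Nat.add_right_comm, Nat.add_assoc] at this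
  obtain ⟨p, hp⟩ := frequently_exists_of_finite
    (P := fun p n => p ∈ O 0 ∧ A.HasPath w (A.peel w (2 * i)) n k p)
    (Filter.Frequently.of_forall fun j => by
      obtain ⟨q, hq⟩ := hne j
      simpa using hpath j 0 q hq (hmem j hq))
  have h1 : p ∈ A.peel w (2 * i + 1) k := mem_peel_odd.2 fun n => by
    obtain ⟨l, hl, h⟩ := Filter.frequently_atTop.1 hp n
    exact h.2.of_le hl
  have h2 := hO 0 hp.exists.choose_spec.1
  have h3 := notMem_peel_vertexRank (q := p) (hm 0)
  rw [h2.2] at h3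
  exact h3 h1

/-- On all late levels the ranks of the vertices of a rejected word form a tight ranking, with the
same maximal rank `2 * m + 1`. The odd ranks that occur bound `m` in terms of the number of
states, so the peeling stops. -/
theorem eventually_tight [Finite σ] (hw : w ∉ A.language) (hne : ∀ k, (A.level w k).Nonempty) :
    ∃ m < Nat.card Q, ∀ᶠ k in Filter.atTop, A.peel w (2 * m + 2) k = ∅ ∧
      ∀ i ≤ m, ∃ q ∈ A.level w k, A.vertexRank w k q = 2 * i + 1 := by
  have := A.finite_states
  let P : ℕ → Prop := fun i => ∃ᶠ k in Filter.atTop, (A.peel w (2 * i) k).Nonempty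
  have hP0 : P 0 := Filter.Frequently.of_forall hne
  have hPanti : ∀ {i j}, i ≤ j → P j → P i := fun {i j} hij hj =>
    hj.mono fun k hk => hk.mono (peel_antitone k (by omega))
  have hodd : ∀ {m}, P m → ∀ᶠ k in Filter.atTop,
      ∀ i : Fin (m + 1), ∃ q ∈ A.level w k, A.vertexRank w k q = 2 * i + 1 := by
    intro m hm
    refine Filter.eventually_all.2 fun i => ?_
    filter_upwards [eventually_exists_odd_rank hw (hPanti (Nat.lt_succ_iff.1 i.2) hm)]
      with k ⟨q, h1, h2⟩
    exact ⟨q, peel_subset_level _ _ h1, vertexRank_eq h1 h2⟩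
  have hbound : ∀ {m}, P m → m < Nat.card Q := by
    intro m hm
    obtain ⟨k, hk⟩ := (hodd hm).exists
    choose g _ hg using hk
    have hinj : Function.Injective g := fun i j hij => by
      have h1 := hg i
      have h2 := hg j
      rw [hij] at h1
      exact Fin.ext (by omega)
    simpa using Nat.card_le_card_of_injective g hinj
  classical
  have hex : ∃ m, ¬ P (m + 1) := ⟨Nat.card Q, fun h => by have := hbound h; omega⟩
  obtain ⟨m, hm, hPm⟩ : ∃ m, ¬ P (m + 1) ∧ P m := by
    refine ⟨Nat.find hex, Nat.find_spec hex, ?_⟩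
    rcases h : Nat.find hex with _ | l
    · exact hP0
    · exact not_not.1 (Nat.find_min hex (m := l) (by omega))
  refine ⟨m, hbound hPm, ?_⟩
  filter_upwards [hodd hPm, Filter.not_frequently.1 hm] with k h1 h2
  exact ⟨Set.not_nonempty_iff_eq_empty.1 h2, fun i hi => h1 ⟨i, Nat.lt_succ_of_le hi⟩⟩

end VertexRank

/-! ### Completeness -/

/-- The sequence of breakpoint sets and indices determined by the supports `S` and the rankings
`f` of the macrostates; `r` is the common rank of the rankings. -/
noncomputable def breakpoint (A : BA Q σ) (w : ℕ → σ) (S : ℕ → Set Q) (f : ℕ → Q → ℕ) (r : ℕ) :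
    ℕ → Set Q × ℕ
  | 0 => (∅, 0)
  | j + 1 =>
    let b := breakpoint A w S f r j
    open Classical in
    if b.1 = ∅ then (S (j + 1) ∩ f (j + 1) ⁻¹' {(b.2 + 2) % (r + 1)}, (b.2 + 2) % (r + 1))
    else (A.stepSet b.1 (w j) ∩ f (j + 1) ⁻¹' {b.2}, b.2)

theorem breakpoint_invariant {A : BA Q σ} {w : ℕ → σ} {S : ℕ → Set Q} {f : ℕ → Q → ℕ} {m : ℕ}
    (hS : ∀ j, S (j + 1) = A.stepSet (S j) (w j)) (j : ℕ) :
    Even (A.breakpoint w S f (2 * m + 1) j).2 ∧ (A.breakpoint w S f (2 * m + 1) j).2 ≤ 2 * m ∧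
      (A.breakpoint w S f (2 * m + 1) j).1 ⊆
        S j ∩ f j ⁻¹' {(A.breakpoint w S f (2 * m + 1) j).2} := by
  induction j with
  | zero => simp [breakpoint]
  | succ j ih =>
    obtain ⟨h1, h2, h3⟩ := ih
    rw [breakpoint]
    split_ifs with hb
    · refine ⟨?_, ?_, subset_rfl⟩
      · rw [Nat.even_iff] at h1 ⊢
        show ((_ + 2) % (2 * m + 1 + 1)) % 2 = 0
        rw [show 2 * m + 1 + 1 = 2 * (m + 1) by ring, Nat.mod_mul_right_mod]
        omega
      · rw [Nat.even_iff] at h1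
        have h4 : ((A.breakpoint w S f (2 * m + 1) j).2 + 2) % (2 * m + 1 + 1) < 2 * m + 1 + 1 :=
          Nat.mod_lt _ (by omega)
        have h5 : ((A.breakpoint w S f (2 * m + 1) j).2 + 2) % (2 * m + 1 + 1) % 2 = 0 := by
          rw [show 2 * m + 1 + 1 = 2 * (m + 1) by ring, Nat.mod_mul_right_mod]
          omega
        show ((_ + 2) % (2 * m + 1 + 1)) ≤ _
        omega
    · refine ⟨h1, h2, Set.inter_subset_inter_left _ fun q hq => ?_⟩
      obtain ⟨p, hp, hpq⟩ := mem_stepSet.1 hq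
      rw [hS]
      exact mem_stepSet.2 ⟨p, (h3 hp).1, hpq⟩

/-- The tight part of an accepting run of the complement automaton, starting at level `K`. -/
theorem exists_tight_run [Finite σ] {A : BA Q σ} {w : ℕ → σ} (hw : w ∉ A.language)
    (hne : ∀ k, (A.level w k).Nonempty) :
    ∃ K, ∃ T : ℕ → TightState A,
      (T 0).S = A.level w (K + 1) ∧ (T 0).O = ∅ ∧ (T 0).i = 0 ∧
      (∀ j, T (j + 1) ∈ A.scheweStep₃ (T j) (w (K + 1 + j))) ∧
      ∃ᶠ j in Filter.atTop, (T j).O = ∅ := by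
  have := A.finite_states
  obtain ⟨m, hmn, hev⟩ := eventually_tight hw hne
  obtain ⟨K, hK⟩ := Filter.eventually_atTop.1 hev
  have hpeel : ∀ j, A.peel w (2 * m + 2) (K + 1 + j) = ∅ := fun j => (hK _ (by omega)).1
  have hle : ∀ j q, A.vertexRank w (K + 1 + j) q ≤ 2 * m + 1 := fun j q =>
    vertexRank_le (by simp [hpeel])
  let f : ℕ → Ranking A := fun j =>
    { val := A.vertexRank w (K + 1 + j)
      le_bound := fun q => (hle j q).trans (by omega)
      even_acc := fun q hq => even_vertexRank_of_mem_accStates (hpeel j) hq }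
  let S : ℕ → Set Q := fun j => A.level w (K + 1 + j)
  have hS : ∀ j, S (j + 1) = A.stepSet (S j) (w (K + 1 + j)) := fun j => rfl
  have hodd : ∀ j, ∀ i ≤ m, ∃ q ∈ S j, (f j).val q = 2 * i + 1 := fun j =>
    (hK (K + 1 + j) (by omega)).2
  have hrank : ∀ j, (f j).rank = 2 * m + 1 := by
    intro j
    obtain ⟨q, -, hq⟩ := hodd j m le_rfl
    have : Nonempty Q := ⟨q⟩
    refine le_antisymm (ciSup_le fun p => hle j p) ?_
    rw [← hq]
    exact le_ciSup (f := (f j).val) (Set.finite_range _).bddAbove q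
  have htight : ∀ j, (f j).IsTight (S j) := by
    intro j
    refine ⟨by rw [hrank]; exact odd_two_mul_add_one m, ?_, fun q hq => vertexRank_eq_zero hq⟩
    rintro _ ⟨⟨i, rfl⟩, h⟩
    rw [hrank] at h
    obtain ⟨q, h1, h2⟩ := hodd j i (by omega)
    exact ⟨q, h1, h2⟩
  let b : ℕ → Set Q × ℕ :=
    A.breakpoint (fun j => w (K + 1 + j)) S (fun j => (f j).val) (2 * m + 1)
  have hb : ∀ j, Even (b j).2 ∧ (b j).2 ≤ 2 * m ∧ (b j).1 ⊆ S j ∩ (f j).val ⁻¹' {(b j).2} :=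
    breakpoint_invariant hS
  have hbe : ∀ j, (b j).1 = ∅ → b (j + 1) = (S (j + 1) ∩
      (f (j + 1)).val ⁻¹' {((b j).2 + 2) % (2 * m + 1 + 1)}, ((b j).2 + 2) % (2 * m + 1 + 1)) :=
    fun j hj => if_pos hj
  have hbn : ∀ j, (b j).1 ≠ ∅ → b (j + 1) =
      (A.stepSet (b j).1 (w (K + 1 + j)) ∩ (f (j + 1)).val ⁻¹' {(b j).2}, (b j).2) :=
    fun j hj => if_neg hj
  let T : ℕ → TightState A := fun j =>
    { S := S j
      O := (b j).1
      f := f j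
      i := (b j).2
      f_tight := ⟨(htight j).1, (htight j).2.1.trans (Set.image_mono (Set.subset_univ _)),
        fun q hq => (hq (Set.mem_univ q)).elim⟩
      f_tightOn := htight j
      i_even := (hb j).1
      i_le := by have := (hb j).2.1; omega
      O_sub := (hb j).2.2 }
  -- the tight part starts above level `0`, so that it is entered by a transition
  refine ⟨K, T, rfl, rfl, rfl, fun j => ⟨rfl, ?_, ?_, ?_, ?_⟩, ?_⟩
  · intro q hq
    exact ⟨fun q' h => vertexRank_le_of_step (hpeel j) hq h,
      fun q' h => vertexRank_le_of_accTrans (hpeel j) hq h⟩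
  · exact (hrank j).trans (hrank (j + 1)).symm
  · intro hO
    have h := hbe j hO
    have h2 : (T (j + 1)).i = ((T j).i + 2) % ((T (j + 1)).f.rank + 1) := by
      show (b (j + 1)).2 = ((b j).2 + 2) % ((f (j + 1)).rank + 1)
      rw [hrank, h]
    refine ⟨h2, ?_⟩
    show (b (j + 1)).1 = S (j + 1) ∩ (f (j + 1)).val ⁻¹' {(b (j + 1)).2}
    rw [h]
  · intro hO
    have h := hbn j hO
    refine ⟨show (b (j + 1)).2 = (b j).2 by rw [h], ?_⟩
    show (b (j + 1)).1 = A.stepSet (b j).1 (w (K + 1 + j)) ∩ (f (j + 1)).val ⁻¹' {(b j).2}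
    rw [h]
  · rw [Filter.frequently_atTop]
    intro N
    by_contra! hc
    have hc' : ∀ j, (b (N + j)).1 ≠ ∅ := fun j =>
      Set.nonempty_iff_ne_empty.1 (hc (N + j) (Nat.le_add_right _ _))
    have hconst : ∀ j, (b (N + j)).2 = (b N).2 := by
      intro j
      induction j with
      | zero => rfl
      | succ j ih => rw [← Nat.add_assoc, hbn _ (hc' j), ih]
    obtain ⟨i, hi⟩ := (hb N).1
    obtain ⟨j, hj⟩ := exists_empty_of_even_rank (A := A) (w := w) (k := K + 1 + N) (i := i)
      (O := fun j => (b (N + j)).1)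
      (fun j => by rw [Nat.add_assoc]; exact hpeel (N + j))
      (fun j q hq => by
        have := (hb (N + j)).2.2 hq
        rw [hconst, hi, ← two_mul] at this
        rw [Nat.add_assoc]
        exact this)
      (fun j q hq => by
        have hq' : q ∈ (b (N + j + 1)).1 := hq
        rw [hbn _ (hc' j)] at hq'
        rw [Nat.add_assoc]
        exact hq'.1)
    exact hc' j hj

theorem mem_language_schewe_of_notMem [Finite σ] (A : BA Q σ) {w : ℕ → σ} (hw : w ∉ A.language) :
    w ∈ A.schewe.language := by
  suffices h : ∃ R : ℕ → ScheweState A, A.schewe.IsRunFrom (Sum.inl A.init) w R ∧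
      ∃ᶠ k in Filter.atTop, R k ∈ A.schewe.accStates by
    obtain ⟨R, hR, hacc⟩ := h
    refine Set.mem_biUnion (x := Sum.inl A.init) (Set.mem_singleton _) ⟨R, hR, ?_⟩
    exact hR.isAccepting_iff.2 (hacc.mono fun k hk => ⟨hR.2 k, Or.inl hk⟩)
  by_cases hne : ∀ k, (A.level w k).Nonempty
  · obtain ⟨K, T, hS, hO, hi, hstep, hfreq⟩ := exists_tight_run hw hne
    let R : ℕ → ScheweState A := fun k =>
      if k ≤ K then Sum.inl (A.level w k) else Sum.inr (T (k - (K + 1)))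
    have hRT : ∀ j, R (K + 1 + j) = Sum.inr (T j) := fun j => by
      simp only [R]
      rw [if_neg (by omega), Nat.add_sub_cancel_left]
    refine ⟨R, ⟨if_pos (Nat.zero_le K), fun k => ?_⟩, ?_⟩
    · rcases lt_trichotomy k K with h | rfl | h
      · have h1 : R k = Sum.inl (A.level w k) := if_pos h.le
        have h2 : R (k + 1) = Sum.inl (A.level w (k + 1)) := if_pos h
        rw [h1, h2]
        exact Or.inl ⟨_, rfl, rfl⟩
      · have h1 : R k = Sum.inl (A.level w k) := if_pos le_rfl
        rw [h1, show R (k + 1) = _ from hRT 0]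
        exact Or.inr ⟨_, ⟨hS, hO, hi⟩, rfl⟩
      · obtain ⟨j, rfl⟩ := Nat.exists_eq_add_of_le (Nat.succ_le_of_lt h)
        rw [show R (K.succ + j) = _ from hRT j, show R (K.succ + j + 1) = _ from hRT (j + 1)]
        exact ⟨_, hstep j, rfl⟩
    · rw [Filter.frequently_atTop] at hfreq ⊢
      intro a
      obtain ⟨j, hj, h⟩ := hfreq a
      refine ⟨K + 1 + j, by omega, ?_⟩
      rw [hRT]
      exact Or.inr ⟨_, h, rfl⟩
  · push Not at hne
    obtain ⟨K, hK⟩ := hne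
    refine ⟨fun k => Sum.inl (A.level w k), ⟨rfl, fun k => Or.inl ⟨_, rfl, rfl⟩⟩, ?_⟩
    refine (Filter.eventually_atTop.2 ⟨K, fun k hk => ?_⟩).frequently
    have : A.level w k = ∅ := by
      induction k, hk using Nat.le_induction with
      | base => exact hK
      | succ k _ ih => simp [level, ih, stepSet]
    exact Or.inl (congrArg Sum.inl this)

end BA

/-- Correctness of Schewe's complementation for Büchi automata with mixed state- and
transition-based acceptance. -/
theorem mainTheorem3 {Q : Type*} {σ : Type*} [Finite σ] [Nonempty σ] (A : BA Q σ) :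
    A.schewe.language = (A.language)ᶜ :=
  Set.Subset.antisymm (fun _ hw => BA.disjoint_language_schewe A hw)
    fun _ hw => BA.mem_language_schewe_of_notMem A hw
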